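/- All systems are finite-dimensional complex Hilbert spaces of positive dimension with fixed standard bases; $\mathcal B(A)$ is the algebra of operators on $A$, $d_A=\dim A$, and $\mathcal C(A,B)$ is the set of quantum channels (completely positive trace preserving maps) $\mathcal B(A)\to\mathcal B(B)$. For a hermitian linear map $\Phi:\mathcal B(A)\to\mathcal B(B)$ let $\|\Phi\|_\diamond=\max_\rho\|(\Phi\otimes \mathrm{id}_A)(\rho)\|_1$, the maximum being over all states $\rho$ on $A\otimes A$, where $\|\cdot\|_1$ is the trace norm. An $l$-outcome measurement on a system $C$ is a tuple $(M_1,\dots,M_l)$ of positive semidefinite operators on $C$ with $\sum_j M_j=I_C$. Let $\mathbb M=\{M^1,\dots,M^k\}$ be $l$-outcome measurements on $C$ and $\mathbb N=\{N^1,\dots,N^m\}$ be $n$-outcome measurements on $C$. Let $A_0,A_1,A_0',A_1'$ be systems of dimensions $k,l,m,n$ respectively. Let $\Phi_{\mathbb M}\in\mathcal C(A_0\otimes C,A_1)$ be the channel $$\Phi_{\mathbb M}(X)=\sum_{i=1}^k\sum_{j=1}^l \operatorname{Tr}\big[(|i\rangle\langle i|\otimes M^i_j)X\big]\,|j\rangle\langle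 j|,$$ and define $\Phi_{\mathbb N}\in\mathcal C(A_0'\otimes C,A_1')$ in the same way. We say that $\mathbb M$ can simulate a family $\mathbb N'=\{N'^1,\dots,N'^m\}$ of $n$-outcome measurements on $C$ if every $N'^y$ is a convex combination of postprocessings of elements of $\mathbb M$: for each $y$ there are probabilities $q(i|y)$ and conditional probabilities $p_{i,y}(x|j)$ with $N'^y_x=\sum_i q(i|y)\sum_j p_{i,y}(x|j)M^i_j$ for all $x$. For $\epsilon\ge 0$, $\mathbb N$ is $\epsilon$-simulable by $\mathbb M$ if $\mathbb M$ can simulate some such $\mathbb N'$ with $\|\Phi_{\mathbb N}-\Phi_{\mathbb N'}\|_\diamond\le\epsilon$. Let $\mathcal C_2(A,A')$ be the set of superchannels $\Theta$ consisting of a preprocessing $\Theta_{\rm pre}\in\mathcal C(A_0',R\otimes A_0)$ and a postprocessing $\Theta_{\rm post}\in\mathcal C(R\otimes A_1,A_1')$ for some finite-dimensional ancilla $R$. Such a $\Theta$ acts on the $A$ part of $\Phi\in\mathcal C(A_0\otimes C,A_1)$ by $\Theta(\Phi)=\Theta_{\rm post}\circ(\mathrm{id}_R\otimes\Phi)\circ(\Theta_{\rm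 pre}\otimes\mathrm{id}_C)$. The partial-superchannel conversion distance is $$\delta_{A|A'}(\Phi_{\mathbb M}\|\Phi_{\mathbb N})=\min_{\Theta\in\mathcal C_2(A,A')}\|\Theta(\Phi_{\mathbb M})-\Phi_{\mathbb N}\|_\diamond .$$ **Proposition.** Let $\epsilon\ge0$. The minimum defining $\delta_{A|A'}(\Phi_{\mathbb M}\|\Phi_{\mathbb N})$ is attained, and $\mathbb N$ is $\epsilon$-simulable by $\mathbb M$ if and only if $\delta_{A|A'}(\Phi_{\mathbb M}\|\Phi_{\mathbb N})\le\epsilon$. -/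

import Mathlib

open scoped Kronecker ComplexOrder

namespace QMeas

/-- A linear map `ℬ(A) → ℬ(B)`, where a system is `ℂ^A` for a finite index type `A`, with its
standard basis, and `ℬ(A)` is the algebra of `A × A` complex matrices. -/
abbrev LMap (A B : Type*) := Matrix A A ℂ →ₗ[ℂ] Matrix B B ℂ

/-- `Φ ⊗ id_R`. -/
def tensorId {A B : Type*} (Φ : LMap A B) (R : Type*) : LMap (A × R) (B × R) where
  toFun X := Matrix.of fun p q => Φ (Matrix.of fun a a' => X (a, p.2) (a', q.2)) p.1 q.1
  map_add' X Y := by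
    ext p q
    exact congrFun (congrFun (map_add Φ (Matrix.of fun a a' => X (a, p.2) (a', q.2))
      (Matrix.of fun a a' => Y (a, p.2) (a', q.2))) p.1) q.1
  map_smul' c X := by
    ext p q
    exact congrFun (congrFun (map_smul Φ c (Matrix.of fun a a' => X (a, p.2) (a', q.2))) p.1) q.1

/-- `id_R ⊗ Φ`. -/
def idTensor {A B : Type*} (R : Type*) (Φ : LMap A B) : LMap (R × A) (R × B) where
  toFun X := Matrix.of fun p q => Φ (Matrix.of fun a a' => X (p.1, a) (q.1, a')) p.2 q.2
  map_add' X Y := by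
    ext p q
    exact congrFun (congrFun (map_add Φ (Matrix.of fun a a' => X (p.1, a) (q.1, a'))
      (Matrix.of fun a a' => Y (p.1, a) (q.1, a'))) p.2) q.2
  map_smul' c X := by
    ext p q
    exact congrFun (congrFun (map_smul Φ c (Matrix.of fun a a' => X (p.1, a) (q.1, a'))) p.2) q.2

/-- Complete positivity: `Φ ⊗ id_r` preserves positive semidefiniteness for every `r`. -/
def IsCP {A B : Type*} (Φ : LMap A B) : Prop :=
  ∀ (r : ℕ) (X : Matrix (A × Fin r) (A × Fin r) ℂ), X.PosSemidef →
    (tensorId Φ (Fin r) X).PosSemidef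

/-- Quantum channels: completely positive trace preserving maps. -/
def IsChannel {A B : Type*} [Fintype A] [Fintype B] (Φ : LMap A B) : Prop :=
  IsCP Φ ∧ ∀ X, (Φ X).trace = X.trace

/-- States (density matrices). -/
def IsState {A : Type*} [Fintype A] (ρ : Matrix A A ℂ) : Prop :=
  ρ.PosSemidef ∧ ρ.trace = 1

/-- The trace norm `‖X‖₁ = Tr √(X* X)`, the sum of the singular values. -/
noncomputable def traceNorm {A : Type*} [Fintype A] [DecidableEq A] (X : Matrix A A ℂ) : ℝ :=
  ∑ i, Real.sqrt ((Matrix.isHermitian_conjTranspose_mul_self X).eigenvalues i)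

/-- The diamond norm of a hermitian map `Φ : ℬ(A) → ℬ(B)`: the largest value of
`‖(Φ ⊗ id_A)(ρ)‖₁` over the states `ρ` of `A ⊗ A`. -/
noncomputable def diamondNorm {A B : Type*} [Fintype A] [Fintype B] [DecidableEq B]
    [DecidableEq A] (Φ : LMap A B) : ℝ :=
  ⨆ ρ : {ρ : Matrix (A × A) (A × A) ℂ // IsState ρ}, traceNorm (tensorId Φ A ρ.1)

/-- A superchannel taking channels `A₀ → A₁` to channels `A₀' → A₁'`, given by a preprocessing
channel `A₀' → R A₀` and a postprocessing channel `R A₁ → A₁'`, with an ancilla `R` of arbitrary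
finite dimension. -/
structure Superchannel (A₀ A₁ A₀' A₁' : Type*) [Fintype A₀] [Fintype A₁] [Fintype A₀']
    [Fintype A₁'] where
  anc : ℕ
  pre : LMap A₀' (Fin anc × A₀)
  post : LMap (Fin anc × A₁) A₁'
  pre_isChannel : IsChannel pre
  post_isChannel : IsChannel post

/-- The action `(Θ ⊗ id_B)(Φ)` of a superchannel `Θ` on the first part of a bipartite map
`Φ : A₀ B₀ → A₁ B₁`, that is
`(Θ_post ⊗ id_{B₁}) ∘ (id_R ⊗ Φ) ∘ (Θ_pre ⊗ id_{B₀})`. -/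
def Superchannel.applyPartial {A₀ A₁ A₀' A₁' B₀ B₁ : Type*} [Fintype A₀] [Fintype A₁]
    [Fintype A₀'] [Fintype A₁'] (Θ : Superchannel A₀ A₁ A₀' A₁')
    (Φ : LMap (A₀ × B₀) (A₁ × B₁)) : LMap (A₀' × B₀) (A₁' × B₁) :=
  tensorId Θ.post B₁
    ∘ₗ (Matrix.reindexLinearEquiv ℂ ℂ (Equiv.prodAssoc (Fin Θ.anc) A₁ B₁).symm
        (Equiv.prodAssoc (Fin Θ.anc) A₁ B₁).symm).toLinearMap
    ∘ₗ idTensor (Fin Θ.anc) Φ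
    ∘ₗ (Matrix.reindexLinearEquiv ℂ ℂ (Equiv.prodAssoc (Fin Θ.anc) A₀ B₀)
        (Equiv.prodAssoc (Fin Θ.anc) A₀ B₀)).toLinearMap
    ∘ₗ tensorId Θ.pre B₀

/-- The conversion distance `δ_{A|A'}(Φ₁‖Φ₂)` of bipartite channels by partial superchannels. -/
noncomputable def partialConversionDistance {A₀ A₁ A₀' A₁' B₀ B₁ : Type*} [Fintype A₀]
    [Fintype A₁] [Fintype A₀'] [Fintype A₁'] [Fintype B₀] [Fintype B₁] [DecidableEq A₀']
    [DecidableEq A₁'] [DecidableEq B₀] [DecidableEq B₁]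
    (Φ₁ : LMap (A₀ × B₀) (A₁ × B₁)) (Φ₂ : LMap (A₀' × B₀) (A₁' × B₁)) : ℝ :=
  ⨅ Θ : Superchannel A₀ A₁ A₀' A₁', diamondNorm (Θ.applyPartial Φ₁ - Φ₂)

/-- Measurements on `C` with outcomes in `J`. -/
def IsMeasurement {C J : Type*} [DecidableEq C] [Fintype J] (M : J → Matrix C C ℂ) : Prop :=
  (∀ j, (M j).PosSemidef) ∧ ∑ j, M j = 1

/-- The bipartite channel `Φ_𝕄 : I ⊗ C → J ⊗ 1` of a family `𝕄 = (M^i)_{i ∈ I}` of measurements on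
`C` with outcomes in `J`:
`Φ_𝕄(X) = ∑ i j, Tr[(|i⟩⟨i| ⊗ M^i_j) X] |j⟩⟨j|`.
The second output system is the trivial one-dimensional system, indexed by `Unit`. -/
noncomputable def measChannel {I J C : Type*} [Fintype I] [DecidableEq I] [DecidableEq J]
    [Fintype C] (M : I → J → Matrix C C ℂ) : LMap (I × C) (J × Unit) where
  toFun X := Matrix.diagonal fun j : J × Unit =>
    ∑ i, ((Matrix.single i i (1 : ℂ) ⊗ₖ M i j.1) * X).trace
  map_add' X Y := by
    rw [Matrix.diagonal_add]
    congr 1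
    funext j
    simp [Matrix.mul_add, Finset.sum_add_distrib]
  map_smul' c X := by
    rw [RingHom.id_apply, ← Matrix.diagonal_smul]
    congr 1
    funext j
    simp [Finset.mul_sum]

/-- The Choi matrix `(Φ ⊗ id)(|I⟩⟩⟨⟨I|)`. -/
def choi {A B : Type*} [DecidableEq A] (Φ : LMap A B) : Matrix (B × A) (B × A) ℂ :=
  Matrix.of fun p q => Φ (Matrix.single p.2 q.2 1) p.1 q.1

/-- `Φ_𝕄` has the Choi matrix `∑ i j, |j⟩⟨j| ⊗ |i⟩⟨i| ⊗ (M^i_j)ᵀ`. -/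
theorem choi_measChannel {I J C : Type*} [Fintype I] [DecidableEq I] [Fintype J] [DecidableEq J]
    [Fintype C] [DecidableEq C] (M : I → J → Matrix C C ℂ) :
    choi (measChannel M) = ∑ i, ∑ j,
      Matrix.single (j, ()) (j, ()) (1 : ℂ) ⊗ₖ (Matrix.single i i (1 : ℂ) ⊗ₖ (M i j).transpose) := by
  ext ⟨⟨j, u⟩, ⟨i, c⟩⟩ ⟨⟨j', u'⟩, ⟨i', c'⟩⟩
  simp only [choi, measChannel, LinearMap.coe_mk, AddHom.coe_mk, Matrix.of_apply,
    Matrix.diagonal_apply, Matrix.trace_mul_single, Matrix.kroneckerMap_apply,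
    Matrix.sum_apply, Matrix.single_apply, Matrix.transpose_apply, Prod.mk.injEq, and_true]
  by_cases h : j = j'
  · subst h
    simp [and_comm]
  · have h0 : ∀ x, ¬(x = j ∧ x = j') := fun x hx => h (hx.1.symm.trans hx.2)
    simp [h, h0]

/-- `𝕄` can simulate `ℕ`: every element of the family `N` is a convex combination (with weights
`q i`) of postprocessings (by conditional probabilities `p i j x = p_i(x|j)`) of the elements of
the family `M`. -/
def CanSimulate {I J Y X C : Type*} [Fintype I] [Fintype J] [Fintype X]
    (M : I → J → Matrix C C ℂ) (N : Y → X → Matrix C C ℂ) : Prop :=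
  ∀ y, ∃ q ∈ stdSimplex ℝ I, ∃ p : I → J → X → ℝ, (∀ i j, p i j ∈ stdSimplex ℝ X) ∧
    ∀ x, N y x = ∑ i, q i • ∑ j, p i j x • M i j

/-- `N` is `ε`-simulable by `M`. -/
def IsApproxSimulable {I J Y X C : Type*} [Fintype I] [Fintype J] [Fintype Y] [Fintype X]
    [Fintype C] [DecidableEq Y] [DecidableEq X] [DecidableEq C]
    (ε : ℝ) (M : I → J → Matrix C C ℂ) (N : Y → X → Matrix C C ℂ) : Prop :=
  ∃ N' : Y → X → Matrix C C ℂ, (∀ y, IsMeasurement (N' y)) ∧ CanSimulate M N' ∧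
    diamondNorm (measChannel N - measChannel N') ≤ ε

end QMeas

/-! Superchannels and simulations reach the same distances to `Φ_ℕ`. A simulation is a superchannel
whose pre- and postprocessing are classical (`CanSimulate.exists_superchannel`). Conversely, dephase
the input `A₀'` and the output `A₁'` of `Θ(Φ_𝕄) - Φ_ℕ`. This fixes `Φ_ℕ`, does not increase the
diamond norm (`diamondNorm_le_of_eq_pinch`), and turns `Θ(Φ_𝕄)` into the channel of a family
simulated by `𝕄` (`Superchannel.exists_canSimulate`).

The dimension of the ancilla is unbounded, so the minimum is not sought over superchannels. It is
found over the compact set of simulation parameters `(q, p)`, on which the distance is lower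
semicontinuous. Both this and the monotonicity under dephasing rest on the duality `‖X‖₁ = max Re
Tr(TX)` over contractions `T`. -/

namespace QMeas

/-! ### Trace norm: duality with contractions, and crude bounds. -/

section TraceNorm

variable {A : Type*} [Fintype A]

theorem diag_mul_conjTranspose_self (Z : Matrix A A ℂ) (i : A) :
    ((Z * Z.conjTranspose) i i).re = ∑ c, ‖Z i c‖ ^ 2 := by
  simp [Matrix.mul_apply, Matrix.conjTranspose_apply, Complex.mul_conj', ← Complex.ofReal_pow]

theorem diag_conjTranspose_mul_self (Z : Matrix A A ℂ) (i : A) :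
    ((Z.conjTranspose * Z) i i).re = ∑ c, ‖Z c i‖ ^ 2 := by
  simp [Matrix.mul_apply, Matrix.conjTranspose_apply, Complex.conj_mul', ← Complex.ofReal_pow]

variable [DecidableEq A]

/-- The singular value decomposition of `XᴴX`, without reference to the chosen eigenbasis. -/
theorem exists_unitary_diagonal_sqrt (X : Matrix A A ℂ) :
    ∃ (V : Matrix A A ℂ) (s : A → ℝ), V * V.conjTranspose = 1 ∧ V.conjTranspose * V = 1 ∧
      (∀ i, 0 ≤ s i) ∧
      V.conjTranspose * (X.conjTranspose * X) * V =
        Matrix.diagonal (fun i => ((s i * s i : ℝ) : ℂ)) ∧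
      traceNorm X = ∑ i, s i := by
  have H := Matrix.isHermitian_conjTranspose_mul_self X
  refine ⟨H.eigenvectorUnitary, fun i => Real.sqrt (H.eigenvalues i), ?_, ?_,
    fun i => Real.sqrt_nonneg _, ?_, rfl⟩
  · exact Unitary.coe_mul_star_self H.eigenvectorUnitary
  · exact Unitary.coe_star_mul_self H.eigenvectorUnitary
  · have h := H.conjStarAlgAut_star_eigenvectorUnitary
    rw [Unitary.conjStarAlgAut_star_apply] at h
    refine h.trans ?_
    congr 1
    funext i
    rw [Real.mul_self_sqrt ((Matrix.posSemidef_conjTranspose_mul_self X).eigenvalues_nonneg i)]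
    rfl

/-- The easy half of the variational formula of the trace norm. -/
theorem re_trace_mul_le_traceNorm {T : Matrix A A ℂ}
    (hT : (1 - T * T.conjTranspose).PosSemidef) (X : Matrix A A ℂ) :
    (T * X).trace.re ≤ traceNorm X := by
  obtain ⟨V, s, hV, hV', hs, hd, ht⟩ := exists_unitary_diagonal_sqrt X
  -- In the eigenbasis `V` of `XᴴX`, apply Cauchy–Schwarz to each diagonal entry: the rows of `VᴴT`
  -- have norm at most 1, and column `i` of `XV` has norm `s i`.
  have h1 : (T * X).trace = ((V.conjTranspose * T) * (X * V)).trace := by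
    rw [Matrix.trace_mul_comm, Matrix.trace_mul_comm (V.conjTranspose * T)]
    rw [show X * V * (V.conjTranspose * T) = X * (V * V.conjTranspose) * T by
      simp only [Matrix.mul_assoc], hV, Matrix.mul_one]
  rw [h1, ht, Matrix.trace, Complex.re_sum]
  refine Finset.sum_le_sum fun i _ => ?_
  have hL : ∑ c, ‖(V.conjTranspose * T) i c‖ ^ 2 ≤ 1 := by
    rw [← diag_mul_conjTranspose_self]
    have h := (hT.conjTranspose_mul_mul_same V).diag_nonneg (i := i)
    have e : V.conjTranspose * (1 - T * T.conjTranspose) * V =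
        1 - (V.conjTranspose * T) * (V.conjTranspose * T).conjTranspose := by
      rw [Matrix.mul_sub, Matrix.sub_mul, Matrix.mul_one, hV', Matrix.conjTranspose_mul,
        Matrix.conjTranspose_conjTranspose]
      simp only [Matrix.mul_assoc]
    rw [e, Complex.le_def] at h
    simpa using h.1
  have hR : ∑ c, ‖(X * V) c i‖ ^ 2 = s i ^ 2 := by
    rw [← diag_conjTranspose_mul_self, Matrix.conjTranspose_mul,
      show V.conjTranspose * X.conjTranspose * (X * V) =
        V.conjTranspose * (X.conjTranspose * X) * V by simp only [Matrix.mul_assoc], hd,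
      Matrix.diagonal_apply_eq, Complex.ofReal_re, pow_two]
  calc ((V.conjTranspose * T * (X * V)) i i).re
      ≤ ‖(V.conjTranspose * T * (X * V)) i i‖ := Complex.re_le_norm _
    _ ≤ ∑ c, ‖(V.conjTranspose * T) i c‖ * ‖(X * V) c i‖ := by
        rw [Matrix.mul_apply]
        exact (norm_sum_le _ _).trans (by simp)
    _ ≤ Real.sqrt (∑ c, ‖(V.conjTranspose * T) i c‖ ^ 2) * Real.sqrt (∑ c, ‖(X * V) c i‖ ^ 2) :=
        Real.sum_mul_le_sqrt_mul_sqrt _ _ _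
    _ ≤ 1 * s i := by
        rw [hR, Real.sqrt_sq (hs i)]
        exact mul_le_mul_of_nonneg_right (Real.sqrt_le_one.mpr hL) (hs i)
    _ = s i := one_mul _

/-- The trace norm is attained in its variational formula. -/
theorem exists_re_trace_mul_eq_traceNorm (X : Matrix A A ℂ) :
    ∃ T : Matrix A A ℂ, (1 - T * T.conjTranspose).PosSemidef ∧
      (T * X).trace.re = traceNorm X := by
  obtain ⟨V, s, hV, hV', hs, hd, ht⟩ := exists_unitary_diagonal_sqrt X
  -- `V D Vᴴ` is the pseudo-inverse of `√(XᴴX)`: the convention `0⁻¹ = 0` handles zero singular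
  -- values.
  set D : Matrix A A ℂ := Matrix.diagonal fun i => (((s i)⁻¹ : ℝ) : ℂ) with hD
  have hDs : D.conjTranspose = D := by
    rw [hD, Matrix.diagonal_conjTranspose]
    congr 1
    funext i
    simp
  refine ⟨V * D * V.conjTranspose * X.conjTranspose, ?_, ?_⟩
  · have e : 1 - V * D * V.conjTranspose * X.conjTranspose *
        (V * D * V.conjTranspose * X.conjTranspose).conjTranspose =
        V * (1 - D * (V.conjTranspose * (X.conjTranspose * X) * V) * D) * V.conjTranspose := by
      rw [Matrix.mul_sub, Matrix.sub_mul, Matrix.mul_one, hV]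
      simp only [Matrix.conjTranspose_mul, Matrix.conjTranspose_conjTranspose, hDs,
        Matrix.mul_assoc]
    rw [e]
    refine Matrix.PosSemidef.mul_mul_conjTranspose_same ?_ V
    rw [hd, hD, Matrix.diagonal_mul_diagonal, Matrix.diagonal_mul_diagonal, ← Matrix.diagonal_one,
      Matrix.diagonal_sub]
    refine Matrix.PosSemidef.diagonal fun i => ?_
    rw [← Complex.ofReal_mul, ← Complex.ofReal_mul, ← Complex.ofReal_one, ← Complex.ofReal_sub]
    refine Complex.zero_le_real.mpr ?_
    rcases eq_or_ne (s i) 0 with h | h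
    · simp [h]
    · field_simp
      simp
  · have e : (V * D * V.conjTranspose * X.conjTranspose * X).trace =
        (D * (V.conjTranspose * (X.conjTranspose * X) * V)).trace := by
      rw [show V * D * V.conjTranspose * X.conjTranspose * X =
        V * (D * (V.conjTranspose * (X.conjTranspose * X))) by simp only [Matrix.mul_assoc],
        Matrix.trace_mul_comm]
      simp only [Matrix.mul_assoc]
    rw [e, hd, hD, Matrix.diagonal_mul_diagonal, Matrix.trace_diagonal, Complex.re_sum, ht]
    refine Finset.sum_congr rfl fun i _ => ?_
    rw [← Complex.ofReal_mul, Complex.ofReal_re]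
    rcases eq_or_ne (s i) 0 with h | h
    · simp [h]
    · field_simp

/-- An optimal `T` at `X` gives a continuous minorant `Re Tr(T ·)` that touches the trace norm at
`X`. -/
theorem lowerSemicontinuous_traceNorm :
    LowerSemicontinuous (traceNorm : Matrix A A ℂ → ℝ) := by
  intro X y hy
  obtain ⟨T, hT, hX⟩ := exists_re_trace_mul_eq_traceNorm X
  have hc : Continuous fun Z : Matrix A A ℂ => (T * Z).trace.re :=
    Complex.continuous_re.comp (Continuous.matrix_trace (continuous_const.matrix_mul continuous_id))
  have := hc.continuousAt.eventually (lt_mem_nhds (a := y) (b := (T * X).trace.re) (hX ▸ hy))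
  filter_upwards [this] with Z hZ using lt_of_lt_of_le hZ (re_trace_mul_le_traceNorm hT Z)

theorem traceNorm_neg (X : Matrix A A ℂ) : traceNorm (-X) = traceNorm X := by
  have h : ∀ P Q : Matrix A A ℂ, P = Q → ∀ (hP : P.IsHermitian) (hQ : Q.IsHermitian),
      ∑ i, Real.sqrt (hP.eigenvalues i) = ∑ i, Real.sqrt (hQ.eigenvalues i) := by
    rintro P _ rfl _ _
    rfl
  exact h _ _ (by simp) _ _

theorem traceNorm_nonneg (X : Matrix A A ℂ) : 0 ≤ traceNorm X :=
  Finset.sum_nonneg fun _ _ => Real.sqrt_nonneg _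

/-- Each singular value is at most the Frobenius norm. The right side is visibly continuous, which
suffices for boundedness over states. -/
theorem traceNorm_le_sqrt_trace (X : Matrix A A ℂ) :
    traceNorm X ≤ Fintype.card A * Real.sqrt (X.conjTranspose * X).trace.re := by
  have H := Matrix.isHermitian_conjTranspose_mul_self X
  have h0 := (Matrix.posSemidef_conjTranspose_mul_self X).eigenvalues_nonneg
  refine (Finset.sum_le_card_nsmul _ _ _ fun i _ => Real.sqrt_le_sqrt ?_).trans_eq
    (nsmul_eq_mul _ _)
  rw [H.trace_eq_sum_eigenvalues]
  simp only [Complex.coe_algebraMap, Complex.re_sum, Complex.ofReal_re]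
  exact Finset.single_le_sum (f := H.eigenvalues) (fun i _ => h0 i) (Finset.mem_univ i)

-- Write `ρ = BᴴB`: the unit trace bounds the columns of `B`, and Cauchy–Schwarz bounds the entries.
-- States thus lie in a compact box.
open scoped MatrixOrder Matrix.Norms.L2Operator in
theorem IsState.norm_apply_le_one {ρ : Matrix A A ℂ} (hρ : IsState ρ) (i j : A) :
    ‖ρ i j‖ ≤ 1 := by
  obtain ⟨B, hB⟩ := CStarAlgebra.nonneg_iff_eq_star_mul_self.mp hρ.1.nonneg
  replace hB : ρ = B.conjTranspose * B := hB
  have hle : ∀ i, ∑ c, ‖B c i‖ ^ 2 ≤ 1 := fun i => by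
    rw [← diag_conjTranspose_mul_self, ← hB]
    have h1 : ρ.trace.re = 1 := by rw [hρ.2, Complex.one_re]
    rw [← h1, Matrix.trace, Complex.re_sum]
    exact Finset.single_le_sum (f := fun i => (ρ i i).re)
      (fun i _ => (Complex.le_def.mp (hρ.1.diag_nonneg (i := i))).1) (Finset.mem_univ i)
  rw [hB, Matrix.mul_apply]
  calc ‖∑ c, B.conjTranspose i c * B c j‖ ≤ ∑ c, ‖B c i‖ * ‖B c j‖ :=
        (norm_sum_le _ _).trans (by simp)
    _ ≤ Real.sqrt (∑ c, ‖B c i‖ ^ 2) * Real.sqrt (∑ c, ‖B c j‖ ^ 2) :=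
        Real.sum_mul_le_sqrt_mul_sqrt _ _ _
    _ ≤ 1 := mul_le_one₀ (Real.sqrt_le_one.mpr (hle i)) (Real.sqrt_nonneg _)
        (Real.sqrt_le_one.mpr (hle j))

end TraceNorm

/-! ### Diamond norm: finiteness and lower semicontinuity. -/

section DiamondNorm

variable {A B : Type*} [Fintype A] [Fintype B] [DecidableEq A] [DecidableEq B]

theorem bddAbove_traceNorm_tensorId (Φ : LMap A B) :
    BddAbove (Set.range fun ρ : {ρ : Matrix (A × A) (A × A) ℂ // IsState ρ} =>
      traceNorm (tensorId Φ A ρ.1)) := by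
  have hK : IsCompact (Set.univ.pi fun _ : A × A => Set.univ.pi fun _ : A × A =>
      Metric.closedBall (0 : ℂ) 1) :=
    isCompact_univ_pi fun _ => isCompact_univ_pi fun _ => isCompact_closedBall 0 1
  have hL : Continuous fun X : Matrix (A × A) (A × A) ℂ => tensorId Φ A X :=
    LinearMap.continuous_of_finiteDimensional _
  have hc : Continuous fun X : Matrix (A × A) (A × A) ℂ => (Fintype.card (B × A) : ℝ) *
      Real.sqrt ((tensorId Φ A X).conjTranspose * tensorId Φ A X).trace.re :=
    continuous_const.mul (Real.continuous_sqrt.comp (Complex.continuous_re.comp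
      (Continuous.matrix_trace (hL.matrix_conjTranspose.matrix_mul hL))))
  obtain ⟨C, hC⟩ := (hK.image hc).bddAbove
  refine ⟨C, ?_⟩
  rintro _ ⟨ρ, rfl⟩
  refine (traceNorm_le_sqrt_trace _).trans (hC ⟨ρ.1, ?_, rfl⟩)
  intro i _ j _
  simpa using ρ.2.norm_apply_le_one i j

theorem traceNorm_tensorId_le_diamondNorm (Φ : LMap A B) {ρ : Matrix (A × A) (A × A) ℂ}
    (hρ : IsState ρ) : traceNorm (tensorId Φ A ρ) ≤ diamondNorm Φ :=
  le_ciSup (bddAbove_traceNorm_tensorId Φ) ⟨ρ, hρ⟩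

theorem diamondNorm_nonneg (Φ : LMap A B) : 0 ≤ diamondNorm Φ :=
  Real.iSup_nonneg fun _ => traceNorm_nonneg _

/-- The bound `0 ≤ c` covers an empty `A`, where there are no states and the supremum is `0` by
convention. -/
theorem diamondNorm_le {Φ : LMap A B} {c : ℝ} (hc : 0 ≤ c)
    (h : ∀ ρ, IsState ρ → traceNorm (tensorId Φ A ρ) ≤ c) : diamondNorm Φ ≤ c :=
  Real.iSup_le (fun ρ => h ρ.1 ρ.2) hc

theorem diamondNorm_neg (Φ : LMap A B) : diamondNorm (-Φ) = diamondNorm Φ := by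
  have h : ∀ X, tensorId (-Φ) A X = -tensorId Φ A X := fun X => by
    ext p q
    rfl
  simp only [diamondNorm, h, traceNorm_neg]

theorem diamondNorm_sub_comm (Φ Ψ : LMap A B) : diamondNorm (Φ - Ψ) = diamondNorm (Ψ - Φ) := by
  rw [← neg_sub, diamondNorm_neg]

theorem lowerSemicontinuous_diamondNorm {S : Type*} [TopologicalSpace S] {Φ : S → LMap A B}
    (h : ∀ X, Continuous fun s => Φ s X) : LowerSemicontinuous fun s => diamondNorm (Φ s) := by
  refine lowerSemicontinuous_ciSup (fun s => bddAbove_traceNorm_tensorId (Φ s)) fun ρ => ?_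
  refine lowerSemicontinuous_traceNorm.comp (continuous_matrix fun p q => ?_)
  exact (h _).matrix_elem p.1 q.1

end DiamondNorm

/-! ### Pinching (dephasing) contracts the trace norm. -/

section Pinching

variable {A K : Type*} [DecidableEq K]

/-- The pinching of a matrix to the diagonal blocks given by the fibres of `f`. -/
def pinch (f : A → K) (X : Matrix A A ℂ) : Matrix A A ℂ :=
  Matrix.of fun p q => if f p = f q then X p q else 0

variable [Fintype A]

/-- A pinching is a sum of compressions `P_k X P_k` by the diagonal projections onto the fibres. -/
theorem pinch_posSemidef (f : A → K) {X : Matrix A A ℂ} (hX : X.PosSemidef) :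
    (pinch f X).PosSemidef := by
  classical
  have e : pinch f X = ∑ k ∈ Finset.univ.image f,
      (Matrix.diagonal fun a => if f a = k then (1 : ℂ) else 0).conjTranspose * X *
        Matrix.diagonal fun a => if f a = k then (1 : ℂ) else 0 := by
    ext p q
    rw [Matrix.sum_apply]
    simp only [Matrix.diagonal_conjTranspose, Matrix.mul_diagonal, Matrix.diagonal_mul,
      Pi.star_apply]
    rw [Finset.sum_eq_single_of_mem (f p) (Finset.mem_image_of_mem f (Finset.mem_univ p))]
    · by_cases h : f p = f q
      · simp [pinch, h]
      · simp [pinch, h, Ne.symm h]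
    · intro k _ hk
      simp [Ne.symm hk]
  rw [e]
  exact Matrix.posSemidef_sum _ fun k _ => hX.conjTranspose_mul_mul_same _

theorem trace_pinch (f : A → K) (X : Matrix A A ℂ) : (pinch f X).trace = X.trace := by
  simp [Matrix.trace, pinch]

theorem IsState.pinch (f : A → K) {ρ : Matrix A A ℂ} (hρ : IsState ρ) :
    IsState (QMeas.pinch f ρ) :=
  ⟨pinch_posSemidef f hρ.1, (trace_pinch f ρ).trans hρ.2⟩

/-- Self-adjointness moves the pinching from `X` onto the dual contraction `T`. -/
theorem trace_mul_pinch (f : A → K) (T X : Matrix A A ℂ) :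
    (T * pinch f X).trace = (pinch f T * X).trace := by
  simp only [Matrix.trace, Matrix.diag_apply, Matrix.mul_apply, pinch, Matrix.of_apply]
  refine Finset.sum_congr rfl fun i _ => Finset.sum_congr rfl fun j _ => ?_
  by_cases h : f i = f j
  · simp [h]
  · simp [h, Ne.symm h]

/-- By Schur complement, `Z` is a contraction iff the block matrix with identity diagonal blocks and
off-diagonal blocks `Z`, `Zᴴ` is positive. Pinching that matrix along `Sum.elim f f` keeps the
identities and pinches `Z`. -/
theorem pinch_contraction [DecidableEq A] (f : A → K) {T : Matrix A A ℂ}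
    (hT : (1 - T * T.conjTranspose).PosSemidef) :
    (1 - pinch f T * (pinch f T).conjTranspose).PosSemidef := by
  have key : ∀ Z : Matrix A A ℂ, (1 - Z * Z.conjTranspose).PosSemidef ↔
      (Matrix.fromBlocks 1 Z Z.conjTranspose 1).PosSemidef := fun Z => by
    let _ : Invertible (1 : Matrix A A ℂ) := invertibleOne
    rw [Matrix.PosDef.fromBlocks₂₂ _ _ Matrix.PosDef.one]
    simp
  rw [key] at hT ⊢
  have h := pinch_posSemidef (Sum.elim f f) hT
  convert h using 1
  ext (p | p) (q | q) <;> simp [pinch, Matrix.one_apply] <;> grind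

theorem traceNorm_pinch_le [DecidableEq A] (f : A → K) (X : Matrix A A ℂ) :
    traceNorm (pinch f X) ≤ traceNorm X := by
  obtain ⟨T, hT, h⟩ := exists_re_trace_mul_eq_traceNorm (pinch f X)
  rw [← h, trace_mul_pinch]
  exact re_trace_mul_le_traceNorm (pinch_contraction f hT) X

end Pinching

/-! ### Positivity of channels, and classical channels. -/

section Channels

/-- Channels are positive. -/
theorem IsCP.posSemidef {A B : Type*} {Φ : LMap A B} (hΦ : IsCP Φ) {X : Matrix A A ℂ}
    (hX : X.PosSemidef) : (Φ X).PosSemidef :=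
  (hΦ 1 (X.submatrix Prod.fst Prod.fst) (hX.submatrix _)).submatrix fun b => (b, 0)

/-- The classical channel with transition probabilities `W`. -/
noncomputable def classicalChannel {A B : Type*} [Fintype A] [DecidableEq B] (W : A → B → ℝ) :
    LMap A B where
  toFun X := Matrix.diagonal fun b => ∑ a, (W a b : ℂ) * X a a
  map_add' X Y := by
    rw [Matrix.diagonal_add]
    simp [mul_add, Finset.sum_add_distrib]
  map_smul' c X := by
    rw [RingHom.id_apply, ← Matrix.diagonal_smul]
    congr 1
    funext b
    simp [Finset.mul_sum, mul_left_comm]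

theorem classicalChannel_apply {A B : Type*} [Fintype A] [DecidableEq B] (W : A → B → ℝ)
    (X : Matrix A A ℂ) (b b' : B) :
    classicalChannel W X b b' = if b = b' then ∑ a, (W a b : ℂ) * X a a else 0 := by
  simp [classicalChannel, Matrix.diagonal_apply]

theorem isChannel_classicalChannel {A B : Type*} [Fintype A] [Fintype B] [DecidableEq B]
    {W : A → B → ℝ} (hW : ∀ a, W a ∈ stdSimplex ℝ B) : IsChannel (classicalChannel W) := by
  refine ⟨fun r X hX => ?_, fun X => ?_⟩
  · have e : tensorId (classicalChannel W) (Fin r) X = ∑ b, ∑ a,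
        W a b • (Matrix.single b b (1 : ℂ) ⊗ₖ X.submatrix (fun s => (a, s)) fun s => (a, s)) := by
      ext ⟨b, s⟩ ⟨b', s'⟩
      change classicalChannel W _ b b' = _
      rw [classicalChannel_apply]
      simp only [Matrix.sum_apply, Matrix.smul_apply, Matrix.kroneckerMap_apply,
        Matrix.single_apply, Matrix.of_apply, Matrix.submatrix_apply]
      by_cases h : b = b'
      · subst h
        simp
      · have h0 : ∀ x, ¬(x = b ∧ x = b') := fun x hx => h (hx.1.symm.trans hx.2)
        simp [h, h0]
    rw [e]
    refine Matrix.posSemidef_sum _ fun b _ => Matrix.posSemidef_sum _ fun a _ => ?_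
    refine Matrix.PosSemidef.smul ?_ ((hW a).1 b)
    refine Matrix.PosSemidef.kronecker ?_ (hX.submatrix _)
    rw [← Matrix.diagonal_single]
    exact Matrix.PosSemidef.diagonal (Pi.single_nonneg.mpr zero_le_one)
  · simp only [Matrix.trace, Matrix.diag_apply, classicalChannel_apply, if_true]
    rw [Finset.sum_comm]
    refine Finset.sum_congr rfl fun a _ => ?_
    rw [← Finset.sum_mul, ← Complex.ofReal_sum, (hW a).2, Complex.ofReal_one, one_mul]

end Channels

/-! ### Measurement channels in terms of partial traces over `C`. -/

section PartialTrace

variable {A C : Type*} [Fintype C]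

/-- `Tr_C[(1 ⊗ P) X]`. -/
def partialTraceMul (P : Matrix C C ℂ) (X : Matrix (A × C) (A × C) ℂ) : Matrix A A ℂ :=
  ∑ c, ∑ c', P c c' • Matrix.of fun a a' => X (a, c') (a', c)

theorem partialTraceMul_apply (P : Matrix C C ℂ) (X : Matrix (A × C) (A × C) ℂ) (a a' : A) :
    partialTraceMul P X a a' = ∑ c, ∑ c', P c c' * X (a, c') (a', c) := by
  simp [partialTraceMul, Matrix.sum_apply]

theorem partialTraceMul_sum_smul {ι : Type*} (s : Finset ι) (w : ι → ℝ) (P : ι → Matrix C C ℂ)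
    (X : Matrix (A × C) (A × C) ℂ) (a a' : A) :
    partialTraceMul (∑ i ∈ s, w i • P i) X a a' =
      ∑ i ∈ s, (w i : ℂ) * partialTraceMul (P i) X a a' := by
  simp only [partialTraceMul_apply, Matrix.sum_apply, Matrix.smul_apply, Finset.sum_mul,
    Finset.mul_sum, Complex.real_smul]
  symm
  rw [Finset.sum_comm]
  refine Finset.sum_congr rfl fun c _ => ?_
  rw [Finset.sum_comm]
  exact Finset.sum_congr rfl fun c' _ => Finset.sum_congr rfl fun i _ => (mul_assoc _ _ _).symm

theorem partialTraceMul_pinch_fst [Fintype A] [DecidableEq A] (P : Matrix C C ℂ)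
    (X : Matrix (A × C) (A × C) ℂ) :
    partialTraceMul P (pinch Prod.fst X) =
      ∑ y, partialTraceMul P X y y • Matrix.single y y (1 : ℂ) := by
  ext a a'
  rw [Matrix.sum_apply]
  simp only [Matrix.smul_apply, Matrix.single_apply, smul_eq_mul]
  by_cases h : a = a'
  · subst h
    simp [partialTraceMul_apply, pinch]
  · have h0 : ∀ x, ¬(x = a ∧ x = a') := fun x hx => h (hx.1.symm.trans hx.2)
    simp [partialTraceMul_apply, pinch, h, h0]

theorem measChannel_apply {I J : Type*} [Fintype I] [DecidableEq I] [DecidableEq J]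
    (M : I → J → Matrix C C ℂ) (X : Matrix (I × C) (I × C) ℂ) (p q : J × Unit) :
    measChannel M X p q =
      if p.1 = q.1 then ∑ i, partialTraceMul (M i p.1) X i i else 0 := by
  have h : ∀ i j, ((Matrix.single i i (1 : ℂ) ⊗ₖ M i j) * X).trace =
      partialTraceMul (M i j) X i i := fun i j => by
    rw [partialTraceMul_apply]
    simp only [Matrix.trace, Matrix.diag_apply, Matrix.mul_apply, Fintype.sum_prod_type,
      Matrix.kroneckerMap_apply, Matrix.single_apply]
    rw [Finset.sum_eq_single i (fun b _ hb => by simp [Ne.symm hb]) (by simp)]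
    refine Finset.sum_congr rfl fun c _ => ?_
    rw [Finset.sum_eq_single i (fun b _ hb => by simp [Ne.symm hb]) (by simp)]
    simp
  obtain ⟨j, ⟨⟩⟩ := p
  obtain ⟨j', ⟨⟩⟩ := q
  change Matrix.diagonal _ _ _ = _
  simp only [Matrix.diagonal_apply, Prod.mk.injEq, and_true, h]

/-- `Φ_𝕄` reads only the diagonal blocks of its input and writes a diagonal output. -/
theorem measChannel_eq_pinch {I J : Type*} [Fintype I] [DecidableEq I] [DecidableEq J]
    (M : I → J → Matrix C C ℂ) (X : Matrix (I × C) (I × C) ℂ) :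
    measChannel M X = pinch Prod.fst (measChannel M (pinch Prod.fst X)) := by
  ext p q
  by_cases h : p.1 = q.1 <;>
    simp [pinch, measChannel_apply, partialTraceMul_apply, h]

end PartialTrace

/-! ### Superchannels acting on `Φ_𝕄`; simulations as superchannels. -/

section Superchannel

/-- `⟨i|Z|i⟩ ⊗ |j⟩⟨j|` for an operator `Z` on `R ⊗ A₀`. -/
noncomputable def controlBlock {R A₀ A₁ : Type*} [DecidableEq A₁] (i : A₀) (j : A₁) :
    LMap (R × A₀) (R × A₁) where
  toFun Z := Z.submatrix (fun r => (r, i)) (fun r => (r, i)) ⊗ₖ Matrix.single j j (1 : ℂ)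
  map_add' Z W := by
    rw [← Matrix.add_kronecker]
    rfl
  map_smul' c Z := by
    rw [RingHom.id_apply, ← Matrix.smul_kronecker]
    rfl

theorem controlBlock_posSemidef {R A₀ A₁ : Type*} [Fintype R] [Fintype A₁] [DecidableEq A₁]
    (i : A₀) (j : A₁) {Z : Matrix (R × A₀) (R × A₀) ℂ} (hZ : Z.PosSemidef) :
    (controlBlock i j Z).PosSemidef := by
  refine Matrix.PosSemidef.kronecker (hZ.submatrix _) ?_
  rw [← Matrix.diagonal_single]
  exact Matrix.PosSemidef.diagonal (Pi.single_nonneg.mpr zero_le_one)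

theorem trace_controlBlock {R A₀ A₁ : Type*} [Fintype R] [Fintype A₁] [DecidableEq A₁]
    (i : A₀) (j : A₁) (Z : Matrix (R × A₀) (R × A₀) ℂ) :
    (controlBlock i j Z).trace = ∑ r, Z (r, i) (r, i) := by
  change (Matrix.trace (_ ⊗ₖ _)) = _
  rw [Matrix.trace_kronecker, Matrix.trace_single_eq_same, mul_one]
  rfl

variable {I J Y X C : Type*} [Fintype I] [DecidableEq I] [Fintype J] [DecidableEq J]
  [Fintype Y] [Fintype X] [Fintype C]

/-- The preprocessing does not touch `C`, so it commutes with the partial trace against `M i j`; the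
register `A₀` is then read as `i`, and `j` goes to the postprocessing. -/
theorem applyPartial_measChannel_apply (Θ : Superchannel I J Y X) (M : I → J → Matrix C C ℂ)
    (Z : Matrix (Y × C) (Y × C) ℂ) (p q : X × Unit) :
    Θ.applyPartial (measChannel M) Z p q =
      ∑ i, ∑ j, Θ.post (controlBlock i j (Θ.pre (partialTraceMul (M i j) Z))) p.1 q.1 := by
  simp only [← Matrix.sum_apply, ← map_sum]
  change Θ.post _ p.1 q.1 = _
  refine congrArg (fun W => Θ.post W p.1 q.1) ?_
  ext ⟨r, j⟩ ⟨r', j'⟩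
  change measChannel M _ (j, ()) (j', ()) = _
  rw [measChannel_apply]
  simp only [Matrix.sum_apply]
  refine Eq.trans ?_ (Finset.sum_congr rfl fun i _ => Finset.sum_congr rfl fun j₁ _ =>
    (show (Θ.pre (partialTraceMul (M i j₁) Z)) (r, i) (r', i) *
      Matrix.single j₁ j₁ (1 : ℂ) j j' = _ from rfl))
  by_cases h : j = j'
  · subst h
    simp only [if_true, Matrix.single_apply, and_self, mul_ite, mul_one, mul_zero,
      Finset.sum_ite_eq', Finset.mem_univ]
    refine Finset.sum_congr rfl fun i _ => ?_
    rw [partialTraceMul_apply, partialTraceMul]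
    simp only [map_sum, map_smul, Matrix.sum_apply, Matrix.smul_apply, smul_eq_mul]
    rfl
  · have h0 : ∀ x, ¬(x = j ∧ x = j') := fun x hx => h (hx.1.symm.trans hx.2)
    simp [h, h0]

/-- Every simulation of measurements is implemented by a superchannel. -/
theorem CanSimulate.exists_superchannel [DecidableEq Y] [DecidableEq X]
    {M : I → J → Matrix C C ℂ} {N : Y → X → Matrix C C ℂ} (h : CanSimulate M N) :
    ∃ Θ : Superchannel I J Y X, Θ.applyPartial (measChannel M) = measChannel N := by
  choose q hq p hp hN using h
  -- The ancilla is a classical memory for the pair `(y, i)`, on which the postprocessing depends.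
  -- `W₀` draws `i` from `q y`, stores `(y, i)` and emits `i`; `W₁` draws `x` from `p y i j`.
  let e := (Fintype.equivFin (Y × I)).symm
  let W₀ : Y → Fin (Fintype.card (Y × I)) × I → ℝ := fun y b =>
    if e b.1 = (y, b.2) then q y b.2 else 0
  let W₁ : Fin (Fintype.card (Y × I)) × J → X → ℝ := fun b => p (e b.1).1 (e b.1).2 b.2
  have hW₀ : ∀ y, W₀ y ∈ stdSimplex ℝ _ := by
    refine fun y => ⟨fun b => ?_, ?_⟩
    · dsimp only [W₀]
      split_ifs
      exacts [(hq y).1 _, le_rfl]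
    · rw [Fintype.sum_prod_type_right, ← (hq y).2]
      refine Finset.sum_congr rfl fun i _ => ?_
      rw [← e.symm.sum_comp]
      simp [W₀]
  refine ⟨⟨_, classicalChannel W₀, classicalChannel W₁, isChannel_classicalChannel hW₀,
    isChannel_classicalChannel fun b => hp _ _ _⟩, ?_⟩
  refine LinearMap.ext fun Z => ?_
  ext x x'
  rw [applyPartial_measChannel_apply, measChannel_apply]
  simp only [classicalChannel_apply]
  by_cases hx : x.1 = x'.1
  · simp only [hx, if_true]
    have key : ∀ i j, ∑ a, (W₁ a x'.1 : ℂ) * controlBlock i j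
        (classicalChannel W₀ (partialTraceMul (M i j) Z)) a a =
        ∑ y, ((q y i * p y i j x'.1 : ℝ) : ℂ) * partialTraceMul (M i j) Z y y := fun i j => by
      rw [Fintype.sum_prod_type, ← e.symm.sum_comp]
      change ∑ b, ∑ j₁, (W₁ (e.symm b, j₁) x'.1 : ℂ) * (classicalChannel W₀ _
        (e.symm b, i) (e.symm b, i) * Matrix.single j j (1 : ℂ) j₁ j₁) = _
      simp only [Matrix.single_apply, classicalChannel_apply, if_true, and_self, mul_ite, mul_one,
        mul_zero, Finset.sum_ite_eq, Finset.mem_univ, W₀, W₁, Equiv.apply_symm_apply]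
      rw [Fintype.sum_prod_type]
      refine Finset.sum_congr rfl fun y _ => ?_
      rw [Finset.sum_eq_single i (fun b _ hb => by simp [hb]) (by simp),
        Finset.sum_eq_single y (fun b _ hb => by simp [Ne.symm hb]) (by simp)]
      simp only [if_true]
      push_cast
      ring
    simp only [key, hN, partialTraceMul_sum_smul, Finset.mul_sum]
    symm
    rw [Finset.sum_comm]
    refine Finset.sum_congr rfl fun i _ => ?_
    rw [Finset.sum_comm]
    refine Finset.sum_congr rfl fun j _ => Finset.sum_congr rfl fun y _ => ?_
    push_cast
    ring
  · simp [hx]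

end Superchannel

/-! ### Dephasing a superchannel into a simulation, and the optimal simulation. -/

theorem diamondNorm_le_of_eq_pinch {A B K L : Type*} [Fintype A] [Fintype B] [DecidableEq A]
    [DecidableEq B] [DecidableEq K] [DecidableEq L] {Φ Ψ : LMap A B} (f : A → K) (g : B → L)
    (h : ∀ X, Ψ X = pinch g (Φ (pinch f X))) : diamondNorm Ψ ≤ diamondNorm Φ := by
  refine diamondNorm_le (diamondNorm_nonneg Φ) fun ρ hρ => ?_
  have e : tensorId Ψ A ρ = pinch (g ∘ Prod.fst)
      (tensorId Φ A (pinch (f ∘ Prod.fst) ρ)) := by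
    ext p q
    exact congrFun (congrFun (h _) p.1) q.1
  rw [e]
  exact (traceNorm_pinch_le _ _).trans (traceNorm_tensorId_le_diamondNorm Φ (hρ.pinch _))

theorem pinch_sub {A K : Type*} [DecidableEq K] (f : A → K) (X Y : Matrix A A ℂ) :
    pinch f (X - Y) = pinch f X - pinch f Y := by
  ext p q
  by_cases h : f p = f q <;> simp [pinch, h]

section

variable {I J Y X C : Type*} [Fintype I] [Fintype J] [Fintype X]

theorem CanSimulate.isMeasurement [DecidableEq C] {M : I → J → Matrix C C ℂ}
    (hM : ∀ i, IsMeasurement (M i)) {N : Y → X → Matrix C C ℂ} (h : CanSimulate M N) (y : Y) :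
    IsMeasurement (N y) := by
  obtain ⟨q, hq, p, hp, hN⟩ := h y
  refine ⟨fun x => ?_, ?_⟩
  · rw [hN]
    exact Matrix.posSemidef_sum _ fun i _ => Matrix.PosSemidef.smul
      (Matrix.posSemidef_sum _ fun j _ => ((hM i).1 j).smul ((hp i j).1 x)) (hq.1 i)
  · simp only [hN]
    rw [Finset.sum_comm]
    have h1 : ∀ i, ∑ x, q i • ∑ j, p i j x • M i j = q i • (1 : Matrix C C ℂ) := fun i => by
      rw [← Finset.smul_sum, Finset.sum_comm]
      simp only [← Finset.sum_smul, (hp i _).2, one_smul, (hM i).2]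
    simp only [h1, ← Finset.sum_smul, hq.2, one_smul]

variable [DecidableEq I] [DecidableEq J] [Fintype Y] [DecidableEq Y] [DecidableEq X] [Fintype C]

/-- The dephasing of `Θ(Φ_𝕄)` is the channel of a family of measurements simulated by `𝕄`. -/
theorem Superchannel.exists_canSimulate (hX : Nonempty Y → Nonempty X)
    (Θ : Superchannel I J Y X) (M : I → J → Matrix C C ℂ) :
    ∃ N : Y → X → Matrix C C ℂ, CanSimulate M N ∧ ∀ Z, measChannel N Z =
      pinch Prod.fst (Θ.applyPartial (measChannel M) (pinch Prod.fst Z)) := by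
  let σ : Y → Matrix (Fin Θ.anc × I) (Fin Θ.anc × I) ℂ := fun y =>
    Θ.pre (Matrix.single y y 1)
  have hσ : ∀ y, (σ y).PosSemidef := fun y => by
    refine Θ.pre_isChannel.1.posSemidef ?_
    rw [← Matrix.diagonal_single]
    exact Matrix.PosSemidef.diagonal (Pi.single_nonneg.mpr zero_le_one)
  -- `w y i j x` is to be factored as `q(i|y) p_{i,y}(x|j)`.
  let w : Y → I → J → X → ℝ := fun y i j x => (Θ.post (controlBlock i j (σ y)) x x).re
  have hpos : ∀ y i j x, 0 ≤ Θ.post (controlBlock i j (σ y)) x x := fun y i j x =>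
    (Θ.post_isChannel.1.posSemidef (controlBlock_posSemidef i j (hσ y))).diag_nonneg
  have hw : ∀ y i j x, ((w y i j x : ℝ) : ℂ) = Θ.post (controlBlock i j (σ y)) x x :=
    fun y i j x => (Complex.eq_re_of_ofReal_le (hpos y i j x)).symm
  have hw0 : ∀ y i j x, 0 ≤ w y i j x := fun y i j x => (Complex.le_def.mp (hpos y i j x)).1
  let q : Y → I → ℝ := fun y i => ∑ r, (σ y (r, i) (r, i)).re
  -- Trace preservation of the postprocessing makes this sum independent of `j`, so it can serve as
  -- the weight `q(i|y)`.
  have hwq : ∀ y i j, ∑ x, w y i j x = q y i := fun y i j => by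
    have h := (Θ.post_isChannel.2 (controlBlock i j (σ y))).trans (trace_controlBlock i j _)
    simpa [Matrix.trace, w, q] using congrArg Complex.re h
  have hq : ∀ y, q y ∈ stdSimplex ℝ I := fun y => by
    refine ⟨fun i => Finset.sum_nonneg fun r _ =>
      (Complex.le_def.mp ((hσ y).diag_nonneg (i := (r, i)))).1, ?_⟩
    have h := Θ.pre_isChannel.2 (Matrix.single y y 1)
    rw [Matrix.trace_single_eq_same] at h
    have h' := congrArg Complex.re h
    rw [Matrix.trace, Fintype.sum_prod_type_right] at h'
    simpa [q, σ] using h'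
  refine ⟨fun y x => ∑ i, ∑ j, w y i j x • M i j, fun y => ?_, fun Z => ?_⟩
  · obtain ⟨x₀⟩ := hX ⟨y⟩
    -- If `q y i = 0`, any distribution on `X` will do: the nonnegative `w y i j x` sum to zero,
    -- hence vanish.
    refine ⟨q y, hq y, fun i j => if q y i = 0 then Pi.single x₀ 1 else
      fun x => (q y i)⁻¹ * w y i j x, fun i j => ?_, fun x => ?_⟩
    · beta_reduce
      split_ifs with h
      · exact single_mem_stdSimplex ℝ x₀
      · refine ⟨fun x => mul_nonneg (inv_nonneg.mpr ((hq y).1 i)) (hw0 y i j x), ?_⟩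
        rw [← Finset.mul_sum, hwq, inv_mul_cancel₀ h]
    · refine Finset.sum_congr rfl fun i _ => ?_
      rw [Finset.smul_sum]
      refine Finset.sum_congr rfl fun j _ => ?_
      rw [smul_smul]
      congr 1
      beta_reduce
      split_ifs with h
      · rw [h, zero_mul]
        have h0 := hwq y i j
        rw [h, Finset.sum_eq_zero_iff_of_nonneg fun x _ => hw0 y i j x] at h0
        exact h0 x (Finset.mem_univ x)
      · rw [mul_inv_cancel_left₀ h]
  · ext p p'
    rw [measChannel_apply, pinch, Matrix.of_apply, applyPartial_measChannel_apply]
    by_cases h : p.1 = p'.1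
    -- On a dephased input the preprocessing meets only combinations of the `|y⟩⟨y|`, so only the `σ
    -- y` enter.
    · simp only [h, if_true, partialTraceMul_pinch_fst, map_sum, map_smul, Matrix.sum_apply,
        Matrix.smul_apply, smul_eq_mul]
      have h2 : ∀ y x, partialTraceMul (∑ i, ∑ j, w y i j x • M i j) Z y y =
          ∑ i, ∑ j, (w y i j x : ℂ) * partialTraceMul (M i j) Z y y := fun y x => by
        simpa [partialTraceMul_sum_smul] using
          partialTraceMul_sum_smul Finset.univ (fun _ => (1 : ℝ))
            (fun i => ∑ j, w y i j x • M i j) Z y y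
      simp only [h2, hw]
      rw [Finset.sum_comm]
      refine Finset.sum_congr rfl fun i _ => ?_
      rw [Finset.sum_comm]
      exact Finset.sum_congr rfl fun j _ => Finset.sum_congr rfl fun y _ => mul_comm _ _
    · simp [h]

variable [DecidableEq C]

/-- Among the families simulated by `𝕄`, some family is closest to `ℕ`. -/
theorem exists_canSimulate_forall_diamondNorm_le [Nonempty I] (hX : Nonempty Y → Nonempty X)
    (M : I → J → Matrix C C ℂ) (N : Y → X → Matrix C C ℂ) :
    ∃ N₀ : Y → X → Matrix C C ℂ, CanSimulate M N₀ ∧ ∀ N' : Y → X → Matrix C C ℂ,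
      CanSimulate M N' → diamondNorm (measChannel N₀ - measChannel N) ≤
        diamondNorm (measChannel N' - measChannel N) := by
  -- `K` is a product of simplices, hence compact, and `F` maps it onto the families simulated by
  -- `M`.
  let K : Set ((Y → I → ℝ) × (Y → I → J → X → ℝ)) :=
    (Set.univ.pi fun _ => stdSimplex ℝ I) ×ˢ
      (Set.univ.pi fun _ => Set.univ.pi fun _ => Set.univ.pi fun _ => stdSimplex ℝ X)
  let F : (Y → I → ℝ) × (Y → I → J → X → ℝ) → Y → X → Matrix C C ℂ :=
    fun s y x => ∑ i, s.1 y i • ∑ j, s.2 y i j x • M i j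
  have hK : IsCompact K := (isCompact_univ_pi fun _ => isCompact_stdSimplex ℝ I).prod
    (isCompact_univ_pi fun _ => isCompact_univ_pi fun _ => isCompact_univ_pi fun _ =>
      isCompact_stdSimplex ℝ X)
  have hne : K.Nonempty := by
    obtain ⟨i₀⟩ := ‹Nonempty I›
    refine Set.Nonempty.prod ⟨fun _ => Pi.single i₀ 1, fun _ _ => single_mem_stdSimplex ℝ i₀⟩
      ⟨fun y _ _ => Pi.single (hX ⟨y⟩).some 1, fun _ _ _ _ _ _ => single_mem_stdSimplex ℝ _⟩
  have hF : ∀ s ∈ K, CanSimulate M (F s) := fun s hs y =>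
    ⟨s.1 y, hs.1 y trivial, s.2 y, fun i j => hs.2 y trivial i trivial j trivial, fun _ => rfl⟩
  have hlsc : LowerSemicontinuous fun s => diamondNorm (measChannel (F s) - measChannel N) := by
    refine lowerSemicontinuous_diamondNorm fun Z => ?_
    refine continuous_matrix fun p q => ?_
    simp only [LinearMap.sub_apply, Matrix.sub_apply, measChannel_apply, F,
      partialTraceMul_sum_smul]
    by_cases h : p.1 = q.1
    · simp only [h, if_true]
      fun_prop
    · simp only [h, if_false]
      fun_prop
  obtain ⟨s, hs, hmin⟩ := (hlsc.lowerSemicontinuousOn K).exists_isMinOn hne hK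
  refine ⟨F s, hF s hs, fun N' hN' => ?_⟩
  choose q hq p hp hN using hN'
  have e : N' = F (q, p) := funext fun y => funext fun x => hN y x
  rw [e]
  exact hmin ⟨fun y _ => hq y, fun y _ i _ j _ => hp y i j⟩

/-- A superchannel applied to `Φ_𝕄` is no closer to `Φ_ℕ` than some family simulated by `𝕄`. -/
theorem Superchannel.exists_canSimulate_diamondNorm_le (hX : Nonempty Y → Nonempty X)
    (Θ : Superchannel I J Y X) (M : I → J → Matrix C C ℂ) (N : Y → X → Matrix C C ℂ) :
    ∃ N' : Y → X → Matrix C C ℂ, CanSimulate M N' ∧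
      diamondNorm (measChannel N' - measChannel N) ≤
        diamondNorm (Θ.applyPartial (measChannel M) - measChannel N) := by
  obtain ⟨N', hN', h⟩ := Θ.exists_canSimulate hX M
  refine ⟨N', hN', diamondNorm_le_of_eq_pinch Prod.fst Prod.fst fun Z => ?_⟩
  rw [LinearMap.sub_apply, LinearMap.sub_apply, pinch_sub, ← h, ← measChannel_eq_pinch]

end

end QMeas

/-! ### The proposition. -/

theorem mainTheorem11 (k l m n d : ℕ) (hk : 0 < k) (hd : 0 < d)
    (M : Fin k → Fin l → Matrix (Fin d) (Fin d) ℂ) (hM : ∀ i, QMeas.IsMeasurement (M i))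
    (N : Fin m → Fin n → Matrix (Fin d) (Fin d) ℂ) (hN : ∀ y, QMeas.IsMeasurement (N y))
    (ε : ℝ) (hε : 0 ≤ ε) :
    (∃ Θ : QMeas.Superchannel (Fin k) (Fin l) (Fin m) (Fin n),
      QMeas.diamondNorm (Θ.applyPartial (QMeas.measChannel M) - QMeas.measChannel N) =
        QMeas.partialConversionDistance (QMeas.measChannel M) (QMeas.measChannel N)) ∧
    (QMeas.IsApproxSimulable ε M N ↔
      QMeas.partialConversionDistance (QMeas.measChannel M) (QMeas.measChannel N) ≤ ε) := by
  have : Nonempty (Fin k) := ⟨⟨0, hk⟩⟩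
  -- With no outcomes the effects would sum to `0`, which is not the identity as `d > 0`.
  have hX : Nonempty (Fin m) → Nonempty (Fin n) := by
    rintro ⟨y⟩
    by_contra hn
    rw [not_nonempty_iff] at hn
    have h := congrFun (congrFun (hN y).2 ⟨0, hd⟩) ⟨0, hd⟩
    simp at h
  obtain ⟨N₀, hN₀, hmin⟩ := QMeas.exists_canSimulate_forall_diamondNorm_le hX M N
  obtain ⟨Θ₀, hΘ₀⟩ := hN₀.exists_superchannel
  have : Nonempty (QMeas.Superchannel (Fin k) (Fin l) (Fin m) (Fin n)) := ⟨Θ₀⟩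
  have hle : ∀ Θ : QMeas.Superchannel (Fin k) (Fin l) (Fin m) (Fin n),
      QMeas.partialConversionDistance (QMeas.measChannel M) (QMeas.measChannel N) ≤
        QMeas.diamondNorm (Θ.applyPartial (QMeas.measChannel M) - QMeas.measChannel N) :=
    ciInf_le ⟨0, by rintro _ ⟨Θ, rfl⟩; exact QMeas.diamondNorm_nonneg _⟩
  -- The best simulation is itself a superchannel, and dephasing any superchannel yields a
  -- simulation at least as close.
  have heq : QMeas.diamondNorm (QMeas.measChannel N₀ - QMeas.measChannel N) =
      QMeas.partialConversionDistance (QMeas.measChannel M) (QMeas.measChannel N) := by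
    refine le_antisymm (le_ciInf fun Θ => ?_) (hΘ₀ ▸ hle Θ₀)
    obtain ⟨N', hN', h⟩ := Θ.exists_canSimulate_diamondNorm_le hX M N
    exact (hmin N' hN').trans h
  refine ⟨⟨Θ₀, by rw [hΘ₀, heq]⟩, ?_, fun h => ?_⟩
  · rintro ⟨N', -, hN', h⟩
    obtain ⟨Θ, hΘ⟩ := hN'.exists_superchannel
    refine (hle Θ).trans ?_
    rwa [hΘ, QMeas.diamondNorm_sub_comm]
  · exact ⟨N₀, hN₀.isMeasurement hM, hN₀, by rwa [QMeas.diamondNorm_sub_comm, heq]⟩
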